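/- Let $K$ be an algebraically closed field of characteristic zero, let $G$ be a reductive linear algebraic group over $K$ (not necessarily connected; reductive means that the only closed connected unipotent normal subgroup of $G$ is the trivial one), let $X=\operatorname{Spec} A$ be an irreducible affine scheme of finite type over $K$ on which $G$ acts, and let $\pi\colon X\to X/\!\!/G=\operatorname{Spec}(A^G)$ be the natural map. The codimension of a closed subset is the infimum of the codimensions of the irreducible closed subsets contained in it ($+\infty$ for the empty set). Suppose that - $X$ has property $(S_2)$, that is, $\operatorname{depth}(\mathcal{O}_{X,Y})\ge\min(2,\operatorname{codim}_X Y)$ for every irreducible closed subset $Y$ of $X$, where $\mathcal{O}_{X,Y}$ is the local ring of $X$ at the generic point of $Y$; - $U$ is an open subscheme of $X/\!\!/G$ that is normal (all its local rings are integrally closed domains); - the complement $Z$ of $U$ has codimension at least $2$ in $X/\!\!/G$; - $\pi^{-1}(Z)$ has codimension at least $2$ in $X$. Then $X/\!\!/G$ is normal. -/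

import Mathlib

open AlgebraicGeometry CategoryTheory
open scoped TensorProduct MatrixGroups

noncomputable section

namespace QuotNormal

/-! ### Linear algebraic groups over an algebraically closed field

A linear algebraic group over an algebraically closed field `K` is a Zariski closed subgroup `G` of
`GL n K`. In characteristic zero every affine group scheme of finite type over `K` is reduced, so it
is of this form. -/

section Groups

variable {K : Type*} [Field K] {n : ℕ}

/-- Zariski closed subsets of `GL n K`: the common zero sets of families of polynomials in the
matrix entries. -/
def IsZariskiClosed (s : Set (GL (Fin n) K)) : Prop :=
  ∃ P : Set (MvPolynomial (Fin n × Fin n) K),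
    s = {g : GL (Fin n) K | ∀ p ∈ P, MvPolynomial.eval (fun ij => (g : Matrix (Fin n) (Fin n) K) ij.1 ij.2) p = 0}

/-- Connectedness in the Zariski topology (the empty set is allowed; it is applied to subgroups
only): `s` is not covered by two Zariski closed sets that both meet `s` and have no common point
in `s`. -/
def IsZariskiConnected (s : Set (GL (Fin n) K)) : Prop :=
  ∀ a b : Set (GL (Fin n) K), IsZariskiClosed a → IsZariskiClosed b →
    s ⊆ a ∪ b → s ∩ (a ∩ b) = ∅ → s ⊆ a ∨ s ⊆ b

/-- A group of matrices is unipotent if `g - 1` is nilpotent for each of its elements `g`. -/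
def IsUnipotentGroup (N : Subgroup (GL (Fin n) K)) : Prop :=
  ∀ g ∈ N, IsNilpotent ((g : Matrix (Fin n) (Fin n) K) - 1)

/-- A reductive group: a linear algebraic group `G` whose unipotent radical is trivial, that is, the
only closed connected unipotent normal subgroup of `G` is the trivial one. (As usual in
characteristic zero, `G` itself need not be connected.) -/
structure IsReductive (G : Subgroup (GL (Fin n) K)) : Prop where
  isZariskiClosed : IsZariskiClosed (G : Set (GL (Fin n) K))
  eq_bot_of_unipotent : ∀ N : Subgroup (GL (Fin n) K), N ≤ G → (N.subgroupOf G).Normal →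
    IsZariskiClosed (N : Set (GL (Fin n) K)) → IsZariskiConnected (N : Set (GL (Fin n) K)) →
    IsUnipotentGroup N → N = ⊥

/-- The coordinate ring `K[G]` of regular functions on `G`, generated by the matrix entries and the
inverse of the determinant. -/
def regularFunctions (G : Subgroup (GL (Fin n) K)) : Subalgebra K (G → K) :=
  Algebra.adjoin K
    (Set.range (fun (ij : Fin n × Fin n) (g : G) =>
        ((g : GL (Fin n) K) : Matrix (Fin n) (Fin n) K) ij.1 ij.2) ∪
      {fun g : G => (((g : GL (Fin n) K) : Matrix (Fin n) (Fin n) K).det)⁻¹})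

/-- Evaluation of regular functions at a point `g` of `G`. -/
def evalAt (G : Subgroup (GL (Fin n) K)) (g : G) : regularFunctions G →ₐ[K] K :=
  (Pi.evalAlgHom K (fun _ : G => K) g).comp (regularFunctions G).val

variable {A : Type*} [CommRing A] [Algebra K A]

/-- Let `α : G × X → X` be a morphism, where `X = Spec A`, with comorphism `ρ : A → A ⊗ K[G]`.
For `g` in `G` this is the comorphism `A → A` of the morphism `α(g, -) : X → X`. -/
def comorphismAt {G : Subgroup (GL (Fin n) K)} (ρ : A →ₐ[K] A ⊗[K] regularFunctions G) (g : G) :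
    A →ₐ[K] A :=
  ((Algebra.TensorProduct.rid K K A).toAlgHom.comp
    (Algebra.TensorProduct.map (AlgHom.id K A) (evalAt G g))).comp ρ

/-- An action of the algebraic group `G` on the affine `K`-scheme `X = Spec A`, given by the
comorphism `A → A ⊗ K[G]` of a morphism `α : G × X → X` of `K`-schemes with
`α(1, -) = id` and `α(gh, -) = α(g, -) ∘ α(h, -)`. (As `G` is a variety over an algebraically
closed field, it is enough to impose the two laws at the points of `G`.) -/
structure Action (G : Subgroup (GL (Fin n) K)) (A : Type*) [CommRing A] [Algebra K A] where
  coaction : A →ₐ[K] A ⊗[K] regularFunctions G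
  comorphismAt_one : comorphismAt coaction 1 = AlgHom.id K A
  comorphismAt_mul : ∀ g h : G,
    comorphismAt coaction (g * h) = (comorphismAt coaction h).comp (comorphismAt coaction g)

/-- The algebra `A ^ G` of invariant functions: those `a` in `A` whose pullbacks along the action
`G × X → X` and along the projection `G × X → X` agree. -/
def Action.invariants {G : Subgroup (GL (Fin n) K)} (α : Action G A) : Subalgebra K A :=
  AlgHom.equalizer α.coaction Algebra.TensorProduct.includeLeft

end Groups

section Quotient

universe u v

variable {K : Type v} [Field K] {n : ℕ} {G : Subgroup (GL (Fin n) K)}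
  {A : Type u} [CommRing A] [Algebra K A]

/-- The quotient scheme `X // G = Spec (A ^ G)`, where `X = Spec A`. -/
def Action.quotient (α : Action G A) : Scheme.{u} := Spec (CommRingCat.of α.invariants)

/-- The natural map `π : X → X // G`. -/
def Action.quotientMap (α : Action G A) : Spec (CommRingCat.of A) ⟶ α.quotient :=
  Spec.map (CommRingCat.ofHom (algebraMap α.invariants A))

end Quotient

/-! ### Normality, codimension, depth and the condition `(S_i)` -/

section Schemes

universe u

/-- A scheme is normal if all its local rings are integrally closed domains. -/
def IsNormalScheme (X : Scheme.{u}) : Prop :=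
  ∀ x : X, IsDomain (X.presheaf.stalk x) ∧ IsIntegrallyClosed (X.presheaf.stalk x)

/-- The codimension of a closed subset `Z` of a scheme `X`: the infimum of the codimensions of its
irreducible closed subsets, that is, of the closures of its points `z`. The codimension of the
closure of `z` is the supremum of the lengths of the chains of irreducible closed subsets that
start with it, and is the coheight of `z` in the specialization order. The empty set has
codimension `⊤`. -/
def codim {X : Scheme.{u}} (Z : Set X) : ℕ∞ := ⨅ z ∈ Z, Order.coheight z

/-- The depth of a local ring: the supremum of the lengths of the regular sequences in its maximal
ideal. -/
def depth (R : Type*) [CommRing R] [IsLocalRing R] : ℕ∞ :=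
  ⨆ (rs : List R) (_ : (∀ r ∈ rs, r ∈ IsLocalRing.maximalIdeal R) ∧
    RingTheory.Sequence.IsRegular R rs), (rs.length : ℕ∞)

/-- Serre's condition `(S_i)`: the local ring of `X` along every irreducible closed subset `Z` has
depth at least `min i (codim Z)`. Here `Z` is given by its generic point `x`, and the local ring of
`X` along `Z` is the stalk at `x`. -/
def SatisfiesS (i : ℕ) (X : Scheme.{u}) : Prop :=
  ∀ x : X, min (i : ℕ∞) (codim (closure {x} : Set X)) ≤ depth (X.presheaf.stalk x)

end Schemes

end QuotNormal

end

namespace QuotNormal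

open nonZeroDivisors

/-! ### Depth and associated primes. -/

section Depth

variable {R : Type*} [CommRing R] [IsLocalRing R]

/-! Put `B = A^G`. By `(S_2)` and irreducibility, the nilradical is the only associated prime of
`A`, so non-nilpotent elements of `B` are regular in `A`; normality at the image of the generic
point then makes `B` a domain. Let `a/b` be a fraction integral over `B`. Away from `π⁻¹(Z)`,
normality of `U` makes `b` divide `a` locally (`exists_notMem_dvd_mul_of_isIntegral`). By `(S_2)`,
no associated prime of `A/bA` lies in `π⁻¹(Z)`, so `b ∣ a` in `A`
(`SatisfiesS.dvd_of_two_le_codim`). The quotient is again invariant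
(`Action.mem_invariants_of_mul_mem`), hence lies in `B`. -/

theorem exists_isSMulRegular_of_one_le_depth (h : 1 ≤ depth R) :
    ∃ x ∈ IsLocalRing.maximalIdeal R, IsSMulRegular R x := by
  by_contra! hc
  have : depth R = 0 := by
    simp only [depth, ENat.iSup_eq_zero, Nat.cast_eq_zero, List.length_eq_zero_iff]
    rintro (_ | ⟨x, rs⟩) ⟨hm, hr⟩
    · rfl
    · rw [RingTheory.Sequence.isRegular_cons_iff] at hr
      exact absurd hr.1 (hc x (hm x (by simp)))
  simp [this] at h

theorem exists_isSMulRegular_pair_of_two_le_depth (h : 2 ≤ depth R) :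
    ∃ x ∈ IsLocalRing.maximalIdeal R, ∃ y ∈ IsLocalRing.maximalIdeal R,
      IsSMulRegular R x ∧ IsSMulRegular (QuotSMulTop x R) y := by
  by_contra! hc
  have : depth R ≤ 1 := by
    refine iSup₂_le ?_
    rintro (_ | ⟨x, _ | ⟨y, rs⟩⟩) ⟨hm, hr⟩
    · simp
    · simp
    · rw [RingTheory.Sequence.isRegular_cons_iff, RingTheory.Sequence.isRegular_cons_iff] at hr
      exact absurd hr.2.1 (hc x (hm x (by simp)) y (hm y (by simp)) hr.1)
  exact absurd (h.trans this) (by decide)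

theorem eq_zero_of_one_le_depth (h : 1 ≤ depth R) {u : R}
    (hu : ∀ p ∈ IsLocalRing.maximalIdeal R, p * u = 0) : u = 0 := by
  obtain ⟨x, hx, hreg⟩ := exists_isSMulRegular_of_one_le_depth h
  exact hreg (by simpa using hu x hx)

/-- In a local ring of depth at least two, a principal ideal generated by a regular element does
not have the maximal ideal as an associated prime. -/
theorem dvd_of_two_le_depth (h : 2 ≤ depth R) {b u : R} (hb : b ∈ R⁰)
    (hu : ∀ p ∈ IsLocalRing.maximalIdeal R, b ∣ p * u) : b ∣ u := by
  obtain ⟨x, hx, y, hy, hxr, hyr⟩ := exists_isSMulRegular_pair_of_two_le_depth h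
  have hx0 : ∀ {r s : R}, x * r = x * s → r = s := fun h => hxr h
  have hb0 : ∀ {r s : R}, b * r = b * s → r = s := fun h => by
    rwa [mul_cancel_left_mem_nonZeroDivisors hb] at h
  obtain ⟨v, hv⟩ := hu x hx
  -- With `xu = bv` and `yu = bt`, cancelling `b` gives `yv = xt`; regularity of `y` modulo `x` then
  -- yields `x ∣ v`.
  suffices x ∣ v by
    obtain ⟨w, rfl⟩ := this
    exact ⟨w, hx0 (by rw [hv]; ring)⟩
  obtain ⟨t, ht⟩ := hu y hy
  have hyv : y * v = x * t := hb0 (by linear_combination (-y) * hv + x * ht)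
  have hmem : ∀ r : R, (Submodule.Quotient.mk r : QuotSMulTop x R) = 0 ↔ x ∣ r := fun r => by
    rw [Submodule.Quotient.mk_eq_zero, Submodule.mem_smul_pointwise_iff_exists]
    simp [dvd_def, eq_comm]
  rw [← hmem]
  refine hyr ?_
  simp only [smul_zero, ← Submodule.Quotient.mk_smul, smul_eq_mul]
  exact (hmem _).2 ⟨t, hyv⟩

end Depth

section Localization

variable {A S : Type*} [CommRing A] [CommRing S] [Algebra A S] [IsLocalRing S]
  (P : Ideal A) [P.IsPrime] [IsLocalization.AtPrime S P]

theorem dvd_algebraMap_mul_of_mem_maximalIdeal {b u : A} (hu : ∀ p ∈ P, b ∣ p * u) {p : S}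
    (hp : p ∈ IsLocalRing.maximalIdeal S) : algebraMap A S b ∣ p * algebraMap A S u := by
  obtain ⟨c, s, rfl⟩ := IsLocalization.exists_mk'_eq P.primeCompl p
  have hc : c ∈ P := (IsLocalization.AtPrime.mk'_mem_maximal_iff S P c s).1 hp
  rw [mul_comm, IsLocalization.mul_mk'_eq_mk'_of_mul, mul_comm u c]
  obtain ⟨d, hd⟩ := hu c hc
  rw [hd, ← IsLocalization.mul_mk'_eq_mk'_of_mul]
  exact dvd_mul_right _ _

/-- The image of `u` is killed by the maximal ideal, but is nonzero because nothing outside `P`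
kills `u`. -/
theorem not_one_le_depth_of_annihilator {u : A} (hu : ∀ p, p * u = 0 ↔ p ∈ P) :
    ¬ 1 ≤ depth S := fun h => by
  have h0 : algebraMap A S u = 0 := eq_zero_of_one_le_depth h fun p hp => by
    -- Divisibility by `0` encodes vanishing.
    have := dvd_algebraMap_mul_of_mem_maximalIdeal (S := S) P (b := 0) (u := u)
      (fun p hp => by rw [(hu p).2 hp]) hp
    simpa using this
  rw [IsLocalization.map_eq_zero_iff P.primeCompl] at h0
  obtain ⟨s, hs⟩ := h0
  exact s.2 ((hu s).1 hs)

/-- Depth two would give `b ∣ u` in `S`; clearing denominators puts an element outside `P` into the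
colon ideal `(b : u)`, which is `P`. -/
theorem not_two_le_depth_of_colon {b u : A} (hb : b ∈ A⁰) (hu : ∀ p, b ∣ p * u ↔ p ∈ P) :
    ¬ 2 ≤ depth S := fun h => by
  have hbS : algebraMap A S b ∈ S⁰ := IsLocalization.map_nonZeroDivisors_le P.primeCompl S
    (Submonoid.mem_map_of_mem _ hb)
  obtain ⟨v, hv⟩ := dvd_of_two_le_depth h hbS fun p hp =>
    dvd_algebraMap_mul_of_mem_maximalIdeal P (fun p hp => (hu p).2 hp) hp
  obtain ⟨c, s, rfl⟩ := IsLocalization.exists_mk'_eq P.primeCompl v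
  rw [IsLocalization.mul_mk'_eq_mk'_of_mul, IsLocalization.eq_mk'_iff_mul_eq, ← map_mul,
    IsLocalization.eq_iff_exists P.primeCompl] at hv
  obtain ⟨t, ht⟩ := hv
  exact (t * s).2 ((hu _).1 ⟨t * c, by push_cast; linear_combination ht⟩)

end Localization

/-! ### Integral fractions and invariant quotients. -/

section Integral

variable {A S : Type*} [CommRing A] [CommRing S] [Algebra A S]
  (P : Ideal A) [P.IsPrime] [IsLocalization.AtPrime S P]

/-- If a fraction is integral, then the denominators that clear it do not lie in any prime at which
the local ring is integrally closed. -/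
theorem exists_notMem_dvd_mul_of_isIntegral [IsDomain A] [IsDomain S] [IsIntegrallyClosed S]
    {a b : A} {x : FractionRing A} (hx : IsIntegral A x)
    (hxb : x * algebraMap A _ b = algebraMap A _ a) : ∃ s ∉ P, b ∣ s * a := by
  have hAS : Function.Injective (algebraMap A S) :=
    IsLocalization.injective S P.primeCompl_le_nonZeroDivisors
  have hAL : Function.Injective (algebraMap A (FractionRing S)) := by
    rw [IsScalarTower.algebraMap_eq A S]
    exact (IsFractionRing.injective S _).comp hAS
  let φ : FractionRing A →ₐ[A] FractionRing S := IsFractionRing.liftAlgHom (g := Algebra.ofId A _) hAL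
  -- The image of `x` is integral over `S`, so it is some `c/s` in `S`; then `sa = bc`.
  obtain ⟨v, hv⟩ := IsIntegrallyClosed.isIntegral_iff.1 ((hx.map φ).tower_top (A := S))
  obtain ⟨c, s, rfl⟩ := IsLocalization.exists_mk'_eq P.primeCompl v
  refine ⟨s, s.2, c, hAL ?_⟩
  have h1 := congr(φ $hxb)
  have h2 := congr(algebraMap S (FractionRing S) $(IsLocalization.mk'_spec S c s))
  simp only [map_mul, AlgHom.commutes, ← IsScalarTower.algebraMap_apply, hv] at h1 h2 ⊢
  linear_combination (-algebraMap A (FractionRing S) s) * h1 + algebraMap A (FractionRing S) b * h2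

end Integral

section Invariants

variable {K : Type*} [Field K] {n : ℕ} {G : Subgroup (GL (Fin n) K)}
  {A : Type*} [CommRing A] [Algebra K A]

/-- A quotient of two invariants that lies in `A` is invariant. -/
theorem Action.mem_invariants_of_mul_mem (α : Action G A) {b c : A} (hb : b ∈ α.invariants)
    (hb0 : b ∈ A⁰) (hbc : b * c ∈ α.invariants) : c ∈ α.invariants := by
  have hb1 : α.coaction b = b ⊗ₜ 1 := hb
  have hbc1 : α.coaction (b * c) = (b * c) ⊗ₜ 1 := hbc
  -- Flatness over `K` keeps `b ⊗ 1` regular, so it can be cancelled.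
  have hinj : Function.Injective (LinearMap.rTensor (regularFunctions G) (LinearMap.mulLeft K b)) :=
    Module.Flat.rTensor_preserves_injective_linearMap _
      fun r s h => by simpa [mul_cancel_left_mem_nonZeroDivisors hb0] using h
  have hmul : ∀ z : A ⊗[K] regularFunctions G,
      LinearMap.rTensor (regularFunctions G) (LinearMap.mulLeft K b) z = (b ⊗ₜ 1) * z := fun z => by
    induction z with
    | zero => simp
    | add x y hx hy => rw [map_add, hx, hy, mul_add]
    | tmul x y => simp
  change α.coaction c = c ⊗ₜ 1
  apply hinj
  rw [hmul, hmul, ← hb1, ← map_mul, hbc1, hb1]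
  simp

end Invariants

/-! ### Codimension and points of the spectrum. -/

section Codim

universe u

theorem codim_mono {X : Scheme.{u}} {Z W : Set X} (h : Z ⊆ W) : codim W ≤ codim Z :=
  biInf_mono h

/-- Larger points are more generic, so specializations of a non-maximal point are non-maximal. -/
theorem one_le_codim_closure {X : Scheme.{u}} {x : X} (hx : ¬ IsMax x) :
    1 ≤ codim (closure {x} : Set X) := by
  refine le_iInf₂ fun z hz => ?_
  rw [Order.one_le_iff_pos, Order.coheight_pos]
  exact fun h => hx fun y hy => (h (le_trans (specializes_iff_mem_closure.2 hz) hy)).trans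
    (specializes_iff_mem_closure.2 hz)

theorem notMem_of_isMax_of_two_le_codim {X : Scheme.{u}} {Z : Set X} (hZ : 2 ≤ codim Z) {x : X}
    (hx : IsMax x) : x ∉ Z := fun h => by
  have := hZ.trans (iInf₂_le x h)
  simp [Order.coheight_eq_zero.2 hx] at this

theorem SatisfiesS.two_le_depth {X : Scheme.{u}} (hS : SatisfiesS 2 X) {Z : Set X}
    (hZc : IsClosed Z) (hZ : 2 ≤ codim Z) {x : X} (hx : x ∈ Z) : 2 ≤ depth (X.presheaf.stalk x) :=
  (le_min le_rfl (hZ.trans (codim_mono (hZc.closure_subset_iff.2 (by simpa))))).trans (hS x)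

theorem SatisfiesS.one_le_depth {X : Scheme.{u}} (hS : SatisfiesS 2 X) {x : X} (hx : ¬ IsMax x) :
    1 ≤ depth (X.presheaf.stalk x) :=
  (le_min (by norm_num) (one_le_codim_closure hx)).trans (hS x)

theorem Spec.le_iff {A : CommRingCat.{u}} {x y : Spec A} : x ≤ y ↔ y.asIdeal ≤ x.asIdeal :=
  (PrimeSpectrum.le_iff_specializes (y : PrimeSpectrum A) x).symm

end Codim

/-! ### Serre's condition and descent of normality. -/

section Main

universe u

instance Spec.asIdeal_isPrime {A : CommRingCat.{u}} (x : Spec A) : x.asIdeal.IsPrime := x.isPrime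

noncomputable instance Spec.stalkAlgebra {A : CommRingCat.{u}} (x : Spec A) :
    Algebra A ((Spec A).presheaf.stalk x) :=
  StructureSheaf.stalkAlgebra A x

instance Spec.isLocalization_stalk {A : CommRingCat.{u}} (x : Spec A) :
    IsLocalization.AtPrime ((Spec A).presheaf.stalk x) x.asIdeal :=
  StructureSheaf.IsLocalization.to_stalk A x

theorem Spec.isMax_of_asIdeal_eq_nilradical {A : CommRingCat.{u}} {x : Spec A}
    (hx : x.asIdeal = nilradical A) : IsMax x := fun y _ => by
  rw [Spec.le_iff, hx]
  exact nilradical_le_prime _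

theorem isNormalScheme_spec {B : CommRingCat.{u}} [IsDomain B] [IsIntegrallyClosed B] :
    IsNormalScheme (Spec B) := fun x =>
  ⟨IsLocalization.isDomain_of_le_nonZeroDivisors (M := x.asIdeal.primeCompl) _
      x.asIdeal.primeCompl_le_nonZeroDivisors,
    isIntegrallyClosed_of_isLocalization _ x.asIdeal.primeCompl
      x.asIdeal.primeCompl_le_nonZeroDivisors⟩

theorem IsNormalScheme.stalk_of_mem {X : Scheme.{u}} {U : X.Opens} (hU : IsNormalScheme U)
    {x : X} (hx : x ∈ U) :
    IsDomain (X.presheaf.stalk x) ∧ IsIntegrallyClosed (X.presheaf.stalk x) := by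
  obtain ⟨_, _⟩ := hU ⟨x, hx⟩
  let e : U.toScheme.presheaf.stalk ⟨x, hx⟩ ≃+* X.presheaf.stalk x :=
    (U.stalkIso ⟨x, hx⟩).commRingCatIsoToRingEquiv
  exact ⟨e.symm.toMulEquiv.isDomain _, IsIntegrallyClosed.of_equiv e⟩

/-- If `Spec A` is irreducible and satisfies `(S_2)`, then all zero divisors of `A` are nilpotent. -/
theorem SatisfiesS.mem_nonZeroDivisors {A : CommRingCat.{u}} [IsNoetherianRing A]
    [hX : IrreducibleSpace (Spec A)] (hS : SatisfiesS 2 (Spec A)) {s : A} (hs : ¬ IsNilpotent s) :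
    s ∈ A⁰ := by
  by_contra h
  have hmem : s ∈ ⋃ p ∈ associatedPrimes A A, (p : Set A) := by
    rw [biUnion_associatedPrimes_eq_compl_nonZeroDivisors]
    exact h
  simp only [Set.mem_iUnion, AssociatedPrimes.mem_iff, isAssociatedPrime_iff] at hmem
  obtain ⟨P, ⟨hP, w, hw⟩, hsP⟩ := hmem
  have hN : (nilradical A).IsPrime := PrimeSpectrum.irreducibleSpace_iff_isPrime_nilradical.1 hX
  obtain ⟨x, rfl⟩ : ∃ x : Spec A, x.asIdeal = P := ⟨⟨P, hP⟩, rfl⟩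
  let η : Spec A := ⟨nilradical A, hN⟩
  -- At the generic point, `s ∈ P` would be nilpotent; elsewhere `(S_2)` gives depth at least one,
  -- impossible at an associated prime.
  have hx : ¬ IsMax x := fun hmax => hs <| by
    have : η ≤ x := hmax (Spec.le_iff.2 (nilradical_le_prime _))
    exact (Spec.le_iff.1 this) hsP
  exact not_one_le_depth_of_annihilator (S := (Spec A).presheaf.stalk x) x.asIdeal (u := w)
    (fun p => by rw [hw, Submodule.mem_colon_singleton]; simp) (hS.one_le_depth hx)

/-- Divisibility by a regular element of `A` can be tested away from a closed set of codimension
at least two, if `Spec A` satisfies `(S_2)`. -/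
theorem SatisfiesS.dvd_of_two_le_codim {A : CommRingCat.{u}} [IsNoetherianRing A]
    (hS : SatisfiesS 2 (Spec A)) {Z : Set (Spec A)} (hZc : IsClosed Z) (hZ : 2 ≤ codim Z)
    {a b : A} (hb : b ∈ A⁰)
    (h : ∀ x : Spec A, x ∉ Z → ∃ s ∉ x.asIdeal, b ∣ s * a) : b ∣ a := by
  by_contra hab
  let a' : A ⧸ Ideal.span {b} := Ideal.Quotient.mk _ a
  have ha' : a' ≠ 0 := by
    rwa [Ne, Ideal.Quotient.eq_zero_iff_mem, Ideal.mem_span_singleton]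
  -- `P` contains every `s` with `b ∣ s * a`, which forces its point into `Z`.
  obtain ⟨P, hP, hle⟩ := exists_le_isAssociatedPrime_of_isNoetherianRing A a' ha'
  obtain ⟨hP, w, hw⟩ := (isAssociatedPrime_iff).1 hP
  obtain ⟨u, rfl⟩ := Ideal.Quotient.mk_surjective w
  have hsmul : ∀ p r : A, p ∈ (⊥ : Submodule A (A ⧸ Ideal.span {b})).colon
      {Ideal.Quotient.mk _ r} ↔ b ∣ p * r := fun p r => by
    rw [Submodule.mem_colon_singleton, Submodule.mem_bot, ← Ideal.mem_span_singleton,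
      ← Ideal.Quotient.eq_zero_iff_mem, map_mul]
    rfl
  obtain ⟨x, rfl⟩ : ∃ x : Spec A, x.asIdeal = P := ⟨⟨P, hP⟩, rfl⟩
  have hx : x ∈ Z := by
    by_contra hx
    obtain ⟨s, hs, hsa⟩ := h x hx
    exact hs (hle ((hsmul s a).2 hsa))
  exact not_two_le_depth_of_colon (S := (Spec A).presheaf.stalk x) x.asIdeal hb
    (fun p => by rw [hw, hsmul]) (hS.two_le_depth hZc hZ hx)

/-- Let `Spec A` be irreducible Noetherian with `(S_2)` and let `B` be a subring of `A` such that a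
quotient of elements of `B` lies in `B` as soon as it lies in `A`. If `Spec B` is normal on an open
set whose complement has a preimage of codimension at least two, then `B` is normal. -/
theorem SatisfiesS.isNormalScheme_spec {A B : CommRingCat.{u}} [IsNoetherianRing A]
    [hX : IrreducibleSpace (Spec A)] (hS : SatisfiesS 2 (Spec A)) (f : B ⟶ A)
    (hf : Function.Injective f)
    (hdiv : ∀ (b d : B) (c : A), f b ∈ A⁰ → f b * c = f d → c ∈ Set.range f)
    (U : (Spec B).Opens) (hU : IsNormalScheme U)
    (hZ : 2 ≤ codim (Spec.map f ⁻¹' ((U : Set (Spec B))ᶜ))) : IsNormalScheme (Spec B) := by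
  have hN : (nilradical A).IsPrime := PrimeSpectrum.irreducibleSpace_iff_isPrime_nilradical.1 hX
  have hZc : IsClosed (Spec.map f ⁻¹' ((U : Set (Spec B))ᶜ)) :=
    U.isOpen.isClosed_compl.preimage (Spec.map f).continuous
  have hreg : ∀ b : B, b ∉ nilradical B → f b ∈ A⁰ := fun b hb =>
    hS.mem_nonZeroDivisors fun h => hb ((IsNilpotent.map_iff hf).1 h)
  let η : Spec A := ⟨nilradical A, hN⟩
  have hηU : Spec.map f η ∈ U := by
    have := notMem_of_isMax_of_two_le_codim hZ (Spec.isMax_of_asIdeal_eq_nilradical (x := η) rfl)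
    simpa using this
  have hη : ∀ b, b ∈ (Spec.map f η).asIdeal ↔ b ∈ nilradical B := fun b =>
    IsNilpotent.map_iff hf
  -- A nilpotent `b` dies in the stalk at the image of `η`, a domain, so `sb = 0` with `s` not
  -- nilpotent and `f s` regular.
  have hBred : ∀ b ∈ nilradical B, b = 0 := fun b hb => by
    obtain ⟨hdom, -⟩ := hU.stalk_of_mem hηU
    have h0 : algebraMap B ((Spec B).presheaf.stalk (Spec.map f η)) b = 0 :=
      (IsNilpotent.map hb _).eq_zero
    rw [IsLocalization.map_eq_zero_iff (Spec.map f η).asIdeal.primeCompl] at h0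
    obtain ⟨s, hs⟩ := h0
    have hfs := hreg s fun h => s.2 ((hη s).2 h)
    refine hf ?_
    rw [map_zero]
    refine (mul_left_mem_nonZeroDivisors_eq_zero_iff hfs).1 ?_
    rw [← map_mul, hs, map_zero]
  have hreg0 : ∀ b : B, b ≠ 0 → f b ∈ A⁰ := fun b hb => hreg b fun h => hb (hBred b h)
  have : Nontrivial A := (PrimeSpectrum.nontrivial η : _)
  have : Nontrivial B := f.hom.domain_nontrivial
  have : NoZeroDivisors B := ⟨fun {b c} h => by
    by_contra! hc
    refine hc.2 (hf ?_)
    rw [map_zero]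
    refine (mul_left_mem_nonZeroDivisors_eq_zero_iff (hreg0 b hc.1)).1 ?_
    rw [← map_mul, h, map_zero]⟩
  have : IsDomain B := NoZeroDivisors.to_isDomain B
  have : IsIntegrallyClosed B := by
    rw [isIntegrallyClosed_iff (FractionRing B)]
    intro x hx
    obtain ⟨a, b, hb, hxab⟩ := IsFractionRing.div_surjective (A := B) x
    have hb0 : algebraMap B (FractionRing B) b ≠ 0 := by
      simpa using nonZeroDivisors.ne_zero hb
    have hxb : x * algebraMap B _ b = algebraMap B _ a := by
      rw [← hxab, div_mul_cancel₀ _ hb0]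
    have hfb := hreg0 b (nonZeroDivisors.ne_zero hb)
    have hdvd : f b ∣ f a := hS.dvd_of_two_le_codim hZc hZ hfb fun y hy => by
      have hyU : Spec.map f y ∈ U := by simpa using hy
      obtain ⟨_, _⟩ := hU.stalk_of_mem hyU
      obtain ⟨s, hs, hsa⟩ := exists_notMem_dvd_mul_of_isIntegral
        (S := (Spec B).presheaf.stalk (Spec.map f y)) (Spec.map f y).asIdeal hx hxb
      exact ⟨f s, hs, by simpa using map_dvd f.hom hsa⟩
    obtain ⟨c, hc⟩ := hdvd
    obtain ⟨c, rfl⟩ := hdiv b a c hfb hc.symm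
    rw [← map_mul] at hc
    refine ⟨c, mul_right_cancel₀ hb0 ?_⟩
    rw [hxb, hf hc, map_mul, mul_comm]
  exact QuotNormal.isNormalScheme_spec

end Main

end QuotNormal

theorem corollary7p2
    {K : Type*} [Field K] [IsAlgClosed K] [CharZero K]
    {n : ℕ} {G : Subgroup (GL (Fin n) K)} (hG : QuotNormal.IsReductive G)
    {A : Type*} [CommRing A] [Algebra K A] (hA : Algebra.FiniteType K A)
    (hX : IrreducibleSpace (Spec (CommRingCat.of A)))
    (α : QuotNormal.Action G A)
    (U : α.quotient.Opens)
    (hU : QuotNormal.IsNormalScheme U)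
    (hZ : 2 ≤ QuotNormal.codim ((U : Set α.quotient)ᶜ))
    (hpiZ : 2 ≤ QuotNormal.codim (α.quotientMap ⁻¹' ((U : Set α.quotient)ᶜ)))
    (hS : QuotNormal.SatisfiesS 2 (Spec (CommRingCat.of A))) :
    QuotNormal.IsNormalScheme α.quotient := by
  have : IsNoetherianRing A := Algebra.FiniteType.isNoetherianRing K A
  have : IsNoetherianRing (CommRingCat.of A) := this
  refine hS.isNormalScheme_spec (CommRingCat.ofHom (algebraMap α.invariants A))
    Subtype.val_injective (fun b d c hb hc => ?_) U hU hpiZ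
  have hbc : (b : A) * c = d := hc
  exact ⟨⟨c, α.mem_invariants_of_mul_mem b.2 hb (hbc ▸ d.2)⟩, rfl⟩
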